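/- Let $k,d\ge 0$ be integers, let $\Theta\subseteq\mathbb R^k$ be open and let $\theta^0\in\Theta$. Let $A:\Theta\to\mathbb R^d$, and for each $\theta\in\Theta$ let $M(\theta),C(\theta)\in\mathbb R^{d\times d}$ be symmetric positive semidefinite matrices. Assume: 1. for all $\theta\in\Theta$ and all sequences $(\theta_j)$ in $\Theta$, $\theta_j\to\theta$ if and only if $A(\theta_j)\to A(\theta)$; 2. $A$ has continuous first partial derivatives on $\Theta$, and its Jacobian matrix $\dot A(\theta)\in\mathbb R^{d\times k}$ has rank $k$ for every $\theta\in\Theta$; 3. $M$ is continuous on $\Theta$, and there is $\eta>0$ such that $M(\theta)-\eta I_d$ is positive definite for all $\theta$ in a neighborhood of $\theta^0$; 4. for all $\theta\in\Theta$, $C(\theta)M(\theta)C(\theta)=C(\theta)$ and $C(\theta)M(\theta)\dot A(\theta)=\dot A(\theta)$. Let $V^{(n)}$ be random vectors in $\mathbb R^d$, defined on a common probability space, such that $$\sqrt n\,\bigl(V^{(n)}-A(\theta^0)\bigr)\xrightarrow{D}N\bigl(0,C(\theta^0)\bigr).$$ Let $\phi_n:\mathbb R^d\to\mathbb R^k$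 be measurable functions (possibly the same function for all $n$) such that $\phi_n(V^{(n)})\in\Theta$ almost surely and $\phi_n(V^{(n)})\to\theta^0$ in probability. Put $$\hat R^{(n)}(\theta)=n\,\bigl(V^{(n)}-A(\theta)\bigr)^{\top}M\bigl(\phi_n(V^{(n)})\bigr)\bigl(V^{(n)}-A(\theta)\bigr),\qquad\theta\in\Theta,$$ and let $\hat\theta^{(n)}=\arg\min_{\theta\in\Theta}\hat R^{(n)}(\theta)$, meaning that $\hat\theta^{(n)}$ is a random vector with values in $\Theta$ almost surely that, almost surely, minimizes $\hat R^{(n)}$ over $\Theta$ whenever this minimum is attained (and is an arbitrary point of $\Theta$ otherwise). Then $$\hat R^{(n)}\bigl(\hat\theta^{(n)}\bigr)\xrightarrow{D}\chi^2_{\nu-k},\qquad \nu=\operatorname{rank}C(\theta^0),$$ where $\chi^2_m$ is the law of the sum of the squares of $m$ independent standard normal variables, and $\chi^2_0$ is the point mass at $0$. -/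

import Mathlib

open MeasureTheory ProbabilityTheory Filter Topology Matrix

/-- The chi-square distribution with `m` degrees of freedom: the law of the sum of the squares of
`m` independent standard normal variables (the point mass at `0` if `m = 0`). -/
noncomputable def chiSquare (m : ℕ) : Measure ℝ :=
  (Measure.pi fun _ : Fin m => gaussianReal 0 1).map fun x => ∑ i, x i ^ 2

instance isProbabilityMeasure_chiSquare (m : ℕ) : IsProbabilityMeasure (chiSquare m) :=
  Measure.isProbabilityMeasure_map (Measurable.aemeasurable (by fun_prop))

/-- The `d × k` matrix of first partial derivatives of `A` at `θ`. -/
noncomputable def jacobianMatrix {k d : ℕ}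
    (A : EuclideanSpace ℝ (Fin k) → EuclideanSpace ℝ (Fin d)) (θ : EuclideanSpace ℝ (Fin k)) :
    Matrix (Fin d) (Fin k) ℝ :=
  Matrix.of fun i j => fderiv ℝ A θ (EuclideanSpace.single j 1) i

/-- `A` is bicontinuous on `Θ`: for points of `Θ`, `θ_j → θ` if and only if
`A(θ_j) → A(θ)`. -/
def BicontinuousOn {k d : ℕ} (A : EuclideanSpace ℝ (Fin k) → EuclideanSpace ℝ (Fin d))
    (Θ : Set (EuclideanSpace ℝ (Fin k))) : Prop :=
  ∀ θ ∈ Θ, ∀ u : ℕ → EuclideanSpace ℝ (Fin k), (∀ j, u j ∈ Θ) →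
    (Tendsto u atTop (𝓝 θ) ↔ Tendsto (fun j => A (u j)) atTop (𝓝 (A θ)))

/-- The regularity conditions on the model `A` and on the middle matrix `M` over the parameter
space `Θ`, at the true parameter `θ₀`. -/
structure RegularModel {k d : ℕ} (Θ : Set (EuclideanSpace ℝ (Fin k)))
    (θ₀ : EuclideanSpace ℝ (Fin k))
    (A : EuclideanSpace ℝ (Fin k) → EuclideanSpace ℝ (Fin d))
    (M : EuclideanSpace ℝ (Fin k) → Matrix (Fin d) (Fin d) ℝ) : Prop where
  bicontinuous : BicontinuousOn A Θ
  contDiffOn : ContDiffOn ℝ 1 A Θ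
  rank_jacobian : ∀ θ ∈ Θ, (jacobianMatrix A θ).rank = k
  posSemidef : ∀ θ ∈ Θ, (M θ).PosSemidef
  continuousOn : ContinuousOn M Θ
  uniformly_posDef : ∃ η : ℝ, 0 < η ∧
    ∀ᶠ θ in 𝓝 θ₀, (M θ - η • (1 : Matrix (Fin d) (Fin d) ℝ)).PosDef

/-- The quadratic form `n (v - A(θ))ᵀ M(θ') (v - A(θ))`, for data `v` and with the preliminary
estimate `θ'` plugged into the middle matrix. -/
noncomputable def plugInChiSquare {k d : ℕ}
    (A : EuclideanSpace ℝ (Fin k) → EuclideanSpace ℝ (Fin d))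
    (M : EuclideanSpace ℝ (Fin k) → Matrix (Fin d) (Fin d) ℝ)
    (n : ℕ) (v : EuclideanSpace ℝ (Fin d)) (θ' θ : EuclideanSpace ℝ (Fin k)) : ℝ :=
  n * ((v - A θ).ofLp ⬝ᵥ (M θ' *ᵥ (v - A θ).ofLp))

/-! With J the Jacobian at θ₀, replace A by its linearization there and M(φ_n(V)) by M(θ₀).
Minimizing over θ becomes weighted least squares with design J, and the minimum is the quadratic
form of G = M - MJ(JᵀMJ)⁻¹JᵀM at Z = √n(V - A(θ₀)). Under N(0, C) this form is chi-square: the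
identities on C give CGCGC = CGC and tr(CG) = rank C - k (`mul_wlsResidual_mul`,
`trace_mul_wlsResidual`, `map_inner_multivariateGaussian_eq_chiSquare`).

The replacement is justified deterministically. For (v, θ') near (A(θ₀), θ₀) a minimizer exists, and
the minimum differs from the linearized one by at most ε‖v - A(θ₀)‖²
(`eventually_abs_isMinOn_sub_le`). Coercivity of M and continuity of the inverse of A keep
minimizers near θ₀. Since V and φ_n(V) are consistent, the error is o_P(1)(1 + ‖Z‖²), which
Slutsky's theorem removes. -/

section Deterministic

/-! ### Minimization near the truth: localization, existence, linearization. -/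

open scoped RealInnerProductSpace

variable {E F : Type*} [NormedAddCommGroup E] [NormedAddCommGroup F] [InnerProductSpace ℝ F]

theorem abs_inner_apply_sub_le (T T₀ : F →L[ℝ] F) (y y' : F) :
    |⟪y, T y⟫ - ⟪y', T₀ y'⟫| ≤ ‖T - T₀‖ * ‖y‖ ^ 2 + ‖T₀‖ * ‖y - y'‖ * (‖y‖ + ‖y'‖) := by
  have h : ⟪y, T y⟫ - ⟪y', T₀ y'⟫ = ⟪y, (T - T₀) y⟫ + ⟪y - y', T₀ y⟫ + ⟪y', T₀ (y - y')⟫ := by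
    simp only [_root_.sub_apply, map_sub, inner_sub_left, inner_sub_right]
    ring
  have h1 : |⟪y, (T - T₀) y⟫| ≤ ‖y‖ * (‖T - T₀‖ * ‖y‖) :=
    (abs_real_inner_le_norm _ _).trans (by gcongr; exact (T - T₀).le_opNorm y)
  have h2 : |⟪y - y', T₀ y⟫| ≤ ‖y - y'‖ * (‖T₀‖ * ‖y‖) :=
    (abs_real_inner_le_norm _ _).trans (by gcongr; exact T₀.le_opNorm y)
  have h3 : |⟪y', T₀ (y - y')⟫| ≤ ‖y'‖ * (‖T₀‖ * ‖y - y'‖) :=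
    (abs_real_inner_le_norm _ _).trans (by gcongr; exact T₀.le_opNorm _)
  rw [h]
  refine (abs_add_three _ _ _).trans ?_
  linarith

theorem abs_inner_apply_sub_le_mul_sq {T T₀ : F →L[ℝ] F} {x y y' : F} {κ K : ℝ}
    (hκ1 : κ ≤ 1) (hT : ‖T - T₀‖ ≤ κ) (hy : ‖y‖ ≤ K * ‖x‖) (hyy : ‖y - y'‖ ≤ κ * ‖x‖) :
    |⟪y, T y⟫ - ⟪y', T₀ y'⟫| ≤ κ * (K ^ 2 + ‖T₀‖ * (2 * K + 1)) * ‖x‖ ^ 2 := by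
  have hκ : 0 ≤ κ := (norm_nonneg _).trans hT
  have hy' : ‖y'‖ ≤ (K + 1) * ‖x‖ := by
    have h1 : ‖y'‖ ≤ ‖y‖ + ‖y - y'‖ := norm_le_norm_add_norm_sub y y'
    have h2 : κ * ‖x‖ ≤ 1 * ‖x‖ := by gcongr
    linarith
  calc |⟪y, T y⟫ - ⟪y', T₀ y'⟫|
      ≤ ‖T - T₀‖ * ‖y‖ ^ 2 + ‖T₀‖ * ‖y - y'‖ * (‖y‖ + ‖y'‖) := abs_inner_apply_sub_le T T₀ y y'
    _ ≤ κ * (K * ‖x‖) ^ 2 + ‖T₀‖ * (κ * ‖x‖) * (K * ‖x‖ + (K + 1) * ‖x‖) := by gcongr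
    _ = κ * (K ^ 2 + ‖T₀‖ * (2 * K + 1)) * ‖x‖ ^ 2 := by ring

variable {T : E → F →L[ℝ] F} {θ₀ : E}

/-- Near θ₀ the forms are bounded below by η‖y‖² and above by a multiple of ‖x‖², so comparing
values compares norms, uniformly in θ. -/
theorem exists_norm_le_of_inner_apply_le (hT : ContinuousAt T θ₀)
    (hpos : ∃ η : ℝ, 0 < η ∧ ∀ᶠ θ in 𝓝 θ₀, ∀ y, η * ‖y‖ ^ 2 ≤ ⟪y, T θ y⟫) :
    ∃ K : ℝ, 0 ≤ K ∧ ∀ᶠ θ in 𝓝 θ₀, ∀ x y, ⟪y, T θ y⟫ ≤ ⟪x, T θ x⟫ → ‖y‖ ≤ K * ‖x‖ := by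
  obtain ⟨η, hη, hpos⟩ := hpos
  set R := ‖T θ₀‖ + 1
  have hR : 0 ≤ R / η := by positivity
  -- R/η ≤ (R/η + 1)², which avoids a square root.
  refine ⟨R / η + 1, by positivity, ?_⟩
  have hev : ∀ᶠ θ in 𝓝 θ₀, ‖T θ‖ < R := hT.norm.eventually_lt_const (lt_add_one _)
  filter_upwards [hpos, hev] with θ h1 h2 x y hxy
  have h3 : ⟪x, T θ x⟫ ≤ ‖x‖ * (R * ‖x‖) :=
    (real_inner_le_norm _ _).trans (by gcongr; exact (T θ).le_of_opNorm_le h2.le x)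
  have h4 : ‖y‖ ^ 2 ≤ R / η * ‖x‖ ^ 2 := by
    rw [div_mul_eq_mul_div, le_div_iff₀ hη]
    linarith [h1 y]
  refine le_of_sq_le_sq ?_ (by positivity) |> fun h => h
  rw [mul_pow]
  refine h4.trans ?_
  gcongr
  nlinarith

variable {Θ : Set E} {A : E → F}

/-- A point fitting at least as well as θ₀ has residual at most K‖v - A θ₀‖, hence A θ is close to A
θ₀, and `hinv` brings θ itself close. This confines minimizers to any prescribed neighborhood. -/
theorem eventually_mem_of_inner_apply_le (hT : ContinuousAt T θ₀)
    (hpos : ∃ η : ℝ, 0 < η ∧ ∀ᶠ θ in 𝓝 θ₀, ∀ y, η * ‖y‖ ^ 2 ≤ ⟪y, T θ y⟫)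
    (hinv : ∀ U ∈ 𝓝 θ₀, ∃ δ > 0, ∀ θ ∈ Θ, ‖A θ - A θ₀‖ < δ → θ ∈ U) {U : Set E} (hU : U ∈ 𝓝 θ₀) :
    ∀ᶠ p : F × E in 𝓝 (A θ₀, θ₀), ∀ θ ∈ Θ,
      ⟪p.1 - A θ, T p.2 (p.1 - A θ)⟫ ≤ ⟪p.1 - A θ₀, T p.2 (p.1 - A θ₀)⟫ → θ ∈ U := by
  obtain ⟨K, hK, hKev⟩ := exists_norm_le_of_inner_apply_le hT hpos
  obtain ⟨δ, hδ, hδU⟩ := hinv U hU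
  have h1 : ∀ᶠ v in 𝓝 (A θ₀), ‖v - A θ₀‖ < δ / (K + 1) := by
    have := Metric.ball_mem_nhds (A θ₀) (show 0 < δ / (K + 1) by positivity)
    filter_upwards [this] with v hv
    rwa [← dist_eq_norm]
  rw [nhds_prod_eq]
  filter_upwards [h1.prod_mk hKev] with p ⟨hp1, hp2⟩ θ hθ hle
  refine hδU θ hθ ?_
  have h2 := hp2 _ _ hle
  have h3 : ‖A θ - A θ₀‖ ≤ ‖p.1 - A θ₀‖ + ‖p.1 - A θ‖ := by
    have : A θ - A θ₀ = (p.1 - A θ₀) - (p.1 - A θ) := by abel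
    rw [this]
    exact norm_sub_le _ _
  rw [lt_div_iff₀ (by positivity)] at hp1
  linarith

/-- Near the true data, the quadratic form attains its minimum over the parameter space. -/
theorem eventually_exists_isMinOn [ProperSpace E] (hΘ : Θ ∈ 𝓝 θ₀) (hA : ContinuousOn A Θ)
    (hT : ContinuousAt T θ₀)
    (hpos : ∃ η : ℝ, 0 < η ∧ ∀ᶠ θ in 𝓝 θ₀, ∀ y, η * ‖y‖ ^ 2 ≤ ⟪y, T θ y⟫)
    (hinv : ∀ U ∈ 𝓝 θ₀, ∃ δ > 0, ∀ θ ∈ Θ, ‖A θ - A θ₀‖ < δ → θ ∈ U) :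
    ∀ᶠ p : F × E in 𝓝 (A θ₀, θ₀),
      ∃ θ ∈ Θ, IsMinOn (fun θ => ⟪p.1 - A θ, T p.2 (p.1 - A θ)⟫) Θ θ := by
  obtain ⟨r, hr, hrΘ⟩ := Metric.nhds_basis_closedBall.mem_iff.1 hΘ
  filter_upwards [eventually_mem_of_inner_apply_le hT hpos hinv
    (Metric.closedBall_mem_nhds θ₀ hr)] with p hp
  have hcont : ContinuousOn (fun θ => ⟪p.1 - A θ, T p.2 (p.1 - A θ)⟫)
      (Metric.closedBall θ₀ r) := by
    have h := hA.mono hrΘ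
    fun_prop
  obtain ⟨θ, hθ, hmin⟩ := (isCompact_closedBall θ₀ r).exists_isMinOn
    ⟨θ₀, Metric.mem_closedBall_self hr.le⟩ hcont
  refine ⟨θ, hrΘ hθ, fun θ' hθ' => ?_⟩
  by_cases h : θ' ∈ Metric.closedBall θ₀ r
  · exact hmin h
  -- Outside the ball the value exceeds that at the center θ₀.
  · exact le_trans (hmin (Metric.mem_closedBall_self hr.le)) (not_le.1 (mt (hp θ' hθ') h)).le

variable [NormedSpace ℝ E]

/-- Near the true data, the minimum of the quadratic form is, up to an error of smaller order than
the squared distance of the data to the truth, that of the linearized problem. -/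
theorem eventually_abs_isMinOn_sub_le {B : E →L[ℝ] F} {c : NNReal} {H : F →L[ℝ] E}
    (hΘ : Θ ∈ 𝓝 θ₀) (hA : HasFDerivAt A B θ₀) (hB : AntilipschitzWith c B)
    (hT : ContinuousAt T θ₀)
    (hpos : ∃ η : ℝ, 0 < η ∧ ∀ᶠ θ in 𝓝 θ₀, ∀ y, η * ‖y‖ ^ 2 ≤ ⟪y, T θ y⟫)
    (hinv : ∀ U ∈ 𝓝 θ₀, ∃ δ > 0, ∀ θ ∈ Θ, ‖A θ - A θ₀‖ < δ → θ ∈ U)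
    (hopt : ∀ x h, ⟪x - B (H x), T θ₀ (x - B (H x))⟫ ≤ ⟪x - B h, T θ₀ (x - B h)⟫)
    {ε : ℝ} (hε : 0 < ε) :
    ∀ᶠ p : F × E in 𝓝 (A θ₀, θ₀), ∀ θ ∈ Θ,
      IsMinOn (fun θ => ⟪p.1 - A θ, T p.2 (p.1 - A θ)⟫) Θ θ →
      |⟪p.1 - A θ, T p.2 (p.1 - A θ)⟫ -
        ⟪p.1 - A θ₀ - B (H (p.1 - A θ₀)), T θ₀ (p.1 - A θ₀ - B (H (p.1 - A θ₀)))⟫| ≤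
        ε * ‖p.1 - A θ₀‖ ^ 2 := by
  obtain ⟨K₀, hK₀, hKev⟩ := exists_norm_le_of_inner_apply_le hT hpos
  -- b is a Lipschitz constant for inverting A near θ₀; K bounds the residuals at the minimizer (by
  -- K₀) and at the competitor θ₀ + H x (by 2 + ‖B‖‖H‖), relative to ‖x‖. Then κ makes the
  -- perturbation error at most ε, and ρ is the linearization accuracy that yields κ at both points.
  set b : ℝ := 2 * c with hb
  have hb0 : 0 ≤ b := by positivity
  set K := K₀ + 2 + ‖B‖ * ‖H‖ with hKdef
  have hBH : 0 ≤ ‖B‖ * ‖H‖ := by positivity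
  have hK : 0 ≤ K := by positivity
  set D := K ^ 2 + ‖T θ₀‖ * (2 * K + 1) with hD
  have hD0 : 0 ≤ D := by positivity
  set κ := min 1 (ε / (D + 1)) with hκ
  have hκ0 : 0 < κ := by positivity
  have hκ1 : κ ≤ 1 := min_le_left _ _
  have hκε : κ * D ≤ ε := by
    have h1 : κ * (D + 1) ≤ ε := by
      rw [← le_div_iff₀ (by positivity)]
      exact min_le_right _ _
    nlinarith
  set ρ := κ / (b * (K + 1) + ‖H‖ + 1) with hρ
  have hρ0 : 0 < ρ := by positivity
  have hρκ : ρ * (b * (K + 1) + ‖H‖ + 1) = κ := by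
    rw [hρ]; field_simp
  have hbK : 0 ≤ b * (K + 1) := by positivity
  have hρ1 : ρ * (b * (K + 1)) ≤ κ := by
    rw [← hρκ]
    exact mul_le_mul_of_nonneg_left (by linarith [norm_nonneg H]) hρ0.le
  have hρ2 : ρ * ‖H‖ ≤ κ := by
    rw [← hρκ]
    exact mul_le_mul_of_nonneg_left (by linarith) hρ0.le
  clear_value b K D κ ρ
  have hρev := hA.isLittleO.def hρ0
  have hUev : {θ | ‖θ - θ₀‖ ≤ b * ‖A θ - A θ₀‖ ∧ ‖A θ - A θ₀ - B (θ - θ₀)‖ ≤ ρ * ‖θ - θ₀‖} ∈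
      𝓝 θ₀ := by
    -- With this accuracy, c times the linearization remainder is at most ‖θ - θ₀‖ / 2 and can be
    -- absorbed on the left.
    have hσ : (0 : ℝ) < 1 / (2 * c + 1) := by positivity
    filter_upwards [hρev, hA.isLittleO.def hσ] with θ h1 h2
    refine ⟨?_, h1⟩
    have h3 : ‖θ - θ₀‖ ≤ c * ‖B (θ - θ₀)‖ := by
      simpa using hB.le_mul_dist (θ - θ₀) 0
    have h4 : ‖B (θ - θ₀)‖ ≤ ‖A θ - A θ₀‖ + ‖A θ - A θ₀ - B (θ - θ₀)‖ :=
      norm_le_norm_add_norm_sub _ _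
    rw [one_div_mul_eq_div, le_div_iff₀ (by positivity)] at h2
    have hc : (0 : ℝ) ≤ c := c.2
    have h5 : c * ‖B (θ - θ₀)‖ ≤ c * (‖A θ - A θ₀‖ + ‖A θ - A θ₀ - B (θ - θ₀)‖) := by gcongr
    rw [hb]
    linarith [norm_nonneg (A θ - A θ₀ - B (θ - θ₀))]
  have hκT : ∀ᶠ θ in 𝓝 θ₀, ‖T θ - T θ₀‖ ≤ κ := by
    have h := Metric.closedBall_mem_nhds (T θ₀) hκ0
    filter_upwards [hT.eventually_mem h] with θ hθ
    rwa [← dist_eq_norm]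
  have hH : ∀ᶠ v in 𝓝 (A θ₀), θ₀ + H (v - A θ₀) ∈
      Θ ∩ {θ | ‖θ - θ₀‖ ≤ b * ‖A θ - A θ₀‖ ∧ ‖A θ - A θ₀ - B (θ - θ₀)‖ ≤ ρ * ‖θ - θ₀‖} := by
    have hc : Tendsto (fun v => θ₀ + H (v - A θ₀)) (𝓝 (A θ₀)) (𝓝 θ₀) := by
      have : Continuous (fun v => θ₀ + H (v - A θ₀)) := by fun_prop
      simpa using this.tendsto (A θ₀)
    exact hc (inter_mem hΘ hUev)
  have hprod := hH.prod_mk (hKev.and hκT)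
  rw [← nhds_prod_eq] at hprod
  filter_upwards [hprod, eventually_mem_of_inner_apply_le hT hpos hinv hUev]
    with p ⟨⟨hp1, hp2⟩, hp3, hp4⟩ hp5 θ hθ hmin
  set x := p.1 - A θ₀ with hx
  have hle : ⟪p.1 - A θ, T p.2 (p.1 - A θ)⟫ ≤ ⟪x, T p.2 x⟫ := hmin (mem_of_mem_nhds hΘ)
  have hle' : ⟪p.1 - A θ, T p.2 (p.1 - A θ)⟫ ≤
    ⟪p.1 - A (θ₀ + H x), T p.2 (p.1 - A (θ₀ + H x))⟫ := hmin hp1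
  obtain ⟨h1, h2⟩ := hp5 θ hθ hle
  have hy := hp3 _ _ hle
  rw [Set.mem_ofPred_eq, add_sub_cancel_left] at hp2
  have hxn := norm_nonneg x
  have hDx : κ * D * ‖x‖ ^ 2 ≤ ε * ‖x‖ ^ 2 := mul_le_mul_of_nonneg_right hκε (sq_nonneg _)
  rw [hD] at hDx
  have hyK : ‖p.1 - A θ‖ ≤ K * ‖x‖ :=
    hy.trans (mul_le_mul_of_nonneg_right (by rw [hKdef]; linarith) hxn)
  rw [abs_le]
  constructor
  -- Lower bound: the residual at θ is nearly the linear residual at θ - θ₀, which is no better than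
  -- the linear optimum.
  · have hyy : ‖p.1 - A θ - (x - B (θ - θ₀))‖ ≤ κ * ‖x‖ := by
      have e1 : p.1 - A θ - (x - B (θ - θ₀)) = -(A θ - A θ₀ - B (θ - θ₀)) := by rw [hx]; abel
      have e2 : A θ - A θ₀ = x - (p.1 - A θ) := by rw [hx]; abel
      have e3 : ‖A θ - A θ₀‖ ≤ (K + 1) * ‖x‖ := by
        rw [e2, add_mul, one_mul, add_comm]
        exact (norm_sub_le _ _).trans (add_le_add_right hyK _)
      rw [e1, norm_neg]
      calc _ ≤ ρ * (b * ((K + 1) * ‖x‖)) := by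
            refine h2.trans (mul_le_mul_of_nonneg_left (h1.trans ?_) hρ0.le)
            exact mul_le_mul_of_nonneg_left e3 hb0
        _ = ρ * (b * (K + 1)) * ‖x‖ := by ring
        _ ≤ κ * ‖x‖ := mul_le_mul_of_nonneg_right hρ1 hxn
    have hq := abs_inner_apply_sub_le_mul_sq hκ1 hp4
      hyK hyy
    have := (abs_le.1 hq).1
    have := hopt x (θ - θ₀)
    linarith
  -- Upper bound: θ does at least as well as θ₀ + H x, whose residual is nearly the linear optimum.
  · have hyy : ‖p.1 - A (θ₀ + H x) - (x - B (H x))‖ ≤ κ * ‖x‖ := by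
      have e1 : p.1 - A (θ₀ + H x) - (x - B (H x)) =
        -(A (θ₀ + H x) - A θ₀ - B (H x)) := by rw [hx]; abel
      rw [e1, norm_neg]
      calc _ ≤ ρ * (‖H‖ * ‖x‖) := by
            exact hp2.2.trans (mul_le_mul_of_nonneg_left (H.le_opNorm x) hρ0.le)
        _ = ρ * ‖H‖ * ‖x‖ := by ring
        _ ≤ κ * ‖x‖ := mul_le_mul_of_nonneg_right hρ2 hxn
    have hy2 : ‖p.1 - A (θ₀ + H x)‖ ≤ K * ‖x‖ := by
      have e1 : ‖B (H x)‖ ≤ ‖B‖ * (‖H‖ * ‖x‖) :=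
        (B.le_opNorm _).trans (by gcongr; exact H.le_opNorm x)
      have e2 : ‖x - B (H x)‖ ≤ ‖x‖ + ‖B (H x)‖ := norm_sub_le _ _
      have e3 := norm_le_norm_add_norm_sub (x - B (H x)) (p.1 - A (θ₀ + H x))
      rw [norm_sub_rev (x - B (H x))] at e3
      have e4 : κ * ‖x‖ ≤ 1 * ‖x‖ := mul_le_mul_of_nonneg_right hκ1 hxn
      have e5 : 0 ≤ K₀ * ‖x‖ := mul_nonneg hK₀ hxn
      rw [hKdef, add_mul, add_mul]
      linarith
    have hq := abs_inner_apply_sub_le_mul_sq hκ1 hp4 hy2 hyy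
    have := (abs_le.1 hq).2
    linarith

end Deterministic

/-! ### Chi-square laws of Gaussian quadratic forms. -/

section Law

open scoped RealInnerProductSpace

theorem map_sum_sq_eq_chiSquare {ι : Type*} [Fintype ι] (s : Finset ι) :
    (Measure.pi fun _ : ι => gaussianReal 0 1).map (fun x => ∑ i ∈ s, x i ^ 2) =
      chiSquare s.card := by
  have h1 : iIndepFun (fun (i : ι) (x : ι → ℝ) => x i)
      (Measure.pi fun _ : ι => gaussianReal 0 1) :=
    iIndepFun_pi (X := fun _ => id) (fun _ => aemeasurable_id)
  let e := s.equivFin.symm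
  have he : Function.Injective (fun j => (e j : ι)) := Subtype.val_injective.comp e.injective
  have h2 := h1.precomp he
  rw [iIndepFun_iff_map_fun_eq_pi_map (fun j => (measurable_pi_apply (e j : ι)).aemeasurable)] at h2
  have h3 : (fun x : ι → ℝ => ∑ i ∈ s, x i ^ 2) =
      (fun y : Fin s.card → ℝ => ∑ j, y j ^ 2) ∘ fun x j => x (e j) := by
    ext x
    rw [Function.comp_apply, ← Finset.sum_coe_sort s, ← e.sum_comp]
  rw [h3, ← Measure.map_map (by fun_prop) (by fun_prop), h2, chiSquare]
  congr 2
  ext1 j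
  exact (measurePreserving_eval (fun _ : ι => gaussianReal 0 1) (e j : ι)).map_eq

/-- An orthogonal projection has eigenvalues 0 and 1, the latter as often as its trace. In an
eigenbasis the form is the sum of that many squared independent standard normal coordinates. -/
theorem map_inner_stdGaussian_eq_chiSquare {ι : Type*} [Fintype ι] [DecidableEq ι]
    {N : Matrix ι ι ℝ} (hN : N.IsHermitian) (hN2 : N * N = N) {m : ℕ} (hm : N.trace = m) :
    (stdGaussian (EuclideanSpace ℝ ι)).map (fun x => ⟪x, toEuclideanCLM (𝕜 := ℝ) N x⟫) =
      chiSquare m := by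
  classical
  have hev : ∀ i, hN.eigenvalues i * hN.eigenvalues i = hN.eigenvalues i := by
    intro i
    have h1 : N *ᵥ (hN.eigenvectorBasis i).ofLp = _ := hN.mulVec_eigenvectorBasis i
    have h2 : N *ᵥ (N *ᵥ (hN.eigenvectorBasis i).ofLp) = N *ᵥ (hN.eigenvectorBasis i).ofLp := by
      rw [mulVec_mulVec, hN2]
    rw [h1, mulVec_smul, h1, smul_smul] at h2
    refine smul_left_injective ℝ ?_ h2
    intro h3
    exact hN.eigenvectorBasis.orthonormal.ne_zero i (by ext j; simpa using congrFun h3 j)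
  set s : Finset ι := {i | hN.eigenvalues i = 1} with hs
  have hev' : ∀ i, hN.eigenvalues i = if i ∈ s then 1 else 0 := by
    intro i
    by_cases h : hN.eigenvalues i = 1
    · simp [hs, h]
    · have := hev i
      simp only [hs, Finset.mem_filter_univ, h, if_false]
      exact (mul_right_eq_self₀.1 (hev i)).resolve_left h
  have hcard : s.card = m := by
    have h := hN.trace_eq_sum_eigenvalues
    simp only [hev'] at h
    rw [hm] at h
    simp at h
    exact_mod_cast h.symm
  rw [stdGaussian_eq_map_pi_orthonormalBasis hN.eigenvectorBasis, Measure.map_map (by fun_prop)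
    (by fun_prop), ← hcard, ← map_sum_sq_eq_chiSquare]
  congr 1
  ext x
  have hb : ∀ i, toEuclideanCLM (𝕜 := ℝ) N (hN.eigenvectorBasis i) =
      hN.eigenvalues i • hN.eigenvectorBasis i := by
    intro i
    ext j
    rw [ofLp_toEuclideanCLM, hN.mulVec_eigenvectorBasis i]
    rfl
  rw [Function.comp_apply, map_sum]
  simp only [map_smul, hb, smul_smul]
  rw [hN.eigenvectorBasis.orthonormal.inner_sum]
  simp [hev', pow_two, Finset.sum_ite_mem]

/-- Writing the Gaussian vector as R times a standard one, R = √C, turns the form into that of RGR.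
This is a projection even for singular C. -/
theorem map_inner_multivariateGaussian_eq_chiSquare {d : ℕ} {C G : Matrix (Fin d) (Fin d) ℝ}
    (hC : C.PosSemidef) (hG : G.IsHermitian) (hCG : C * G * C * G * C = C * G * C) {m : ℕ}
    (hm : (C * G).trace = m) :
    (multivariateGaussian 0 C).map (fun x => ⟪x, toEuclideanCLM (𝕜 := ℝ) G x⟫) =
      chiSquare m := by
  open scoped MatrixOrder in
  set R := CFC.sqrt C with hR
  have hRR : R * R = C := CFC.sqrt_mul_sqrt_self _ hC.nonneg
  have hRh : R.IsHermitian := (CFC.sqrt_nonneg C).isSelfAdjoint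
  -- R need not be invertible, but (RX)ᵀ(RX) = XᵀCX, so one factor R of C = RR can be cancelled.
  have hcancel : ∀ X : Matrix (Fin d) (Fin d) ℝ, C * X = 0 → R * X = 0 := by
    intro X hX
    rw [← conjTranspose_mul_self_eq_zero, conjTranspose_mul, hRh.eq, Matrix.mul_assoc,
      ← Matrix.mul_assoc R, hRR, hX, Matrix.mul_zero]
  have hcancel' : ∀ X : Matrix (Fin d) (Fin d) ℝ, X * C = 0 → X * R = 0 := by
    intro X hX
    rw [← self_mul_conjTranspose_eq_zero, conjTranspose_mul, hRh.eq, Matrix.mul_assoc,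
      ← Matrix.mul_assoc R, hRR, ← Matrix.mul_assoc, hX, Matrix.zero_mul]
  have hN2 : (R * G * R) * (R * G * R) = R * G * R := by
    have h1 : R * G * R * (R * G * R) = R * ((G * C * G) * R) := by
      rw [← hRR]; simp only [Matrix.mul_assoc]
    rw [h1, ← sub_eq_zero, Matrix.mul_assoc R G R, ← Matrix.mul_sub]
    apply hcancel
    rw [← Matrix.sub_mul, ← Matrix.mul_assoc]
    apply hcancel'
    rw [Matrix.mul_sub, Matrix.sub_mul, sub_eq_zero, ← hCG]
    simp only [Matrix.mul_assoc]
  have hN : (R * G * R).IsHermitian := by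
    have := isHermitian_mul_mul_conjTranspose R hG
    rwa [hRh.eq] at this
  have htr : (R * G * R).trace = m := by
    rw [Matrix.mul_assoc, trace_mul_comm, Matrix.mul_assoc, hRR, trace_mul_comm, hm]
  rw [multivariateGaussian, Measure.map_map (by fun_prop) (by fun_prop),
    ← map_inner_stdGaussian_eq_chiSquare hN hN2 htr]
  congr 1
  ext x
  simp only [Function.comp_apply, zero_add, ← hR, inner_toEuclideanCLM, ofLp_toEuclideanCLM]
  rw [← mulVec_mulVec, ← mulVec_mulVec, dotProduct_mulVec x.ofLp R, ← mulVec_transpose,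
    ← conjTranspose_eq_transpose_of_trivial, hRh.eq]

end Law

/-! ### Algebra of weighted least squares. -/

section WeightedLeastSquares

variable {k d : ℕ}

theorem trace_eq_rank_of_mul_self {P : Matrix (Fin d) (Fin d) ℝ} (hP : P * P = P) :
    P.trace = P.rank := by
  have h1 : IsIdempotentElem (Matrix.toLin' P) := by
    rw [IsIdempotentElem, Module.End.mul_eq_comp, ← Matrix.toLin'_mul, hP]
  have h2 := (LinearMap.IsIdempotentElem.isProj_range _ h1).trace
  rwa [Matrix.trace_toLin'_eq] at h2

theorem mulVec_injective_of_rank_eq {J : Matrix (Fin d) (Fin k) ℝ} (hJ : J.rank = k) :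
    Function.Injective J.mulVec := by
  have h1 := J.mulVecLin.finrank_range_add_finrank_ker
  have h2 : Module.finrank ℝ (LinearMap.range J.mulVecLin) = k := hJ
  rw [h2, Module.finrank_fin_fun, Nat.add_eq_left, Submodule.finrank_eq_zero] at h1
  exact LinearMap.ker_eq_bot.1 h1

/-- The coefficient matrix of weighted least squares with design matrix `J` and weight matrix
`M`. -/
noncomputable def wlsMatrix (M : Matrix (Fin d) (Fin d) ℝ) (J : Matrix (Fin d) (Fin k) ℝ) :
    Matrix (Fin k) (Fin d) ℝ :=
  (Jᵀ * M * J)⁻¹ * Jᵀ * M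

/-- The matrix of the weighted residual sum of squares. -/
noncomputable def wlsResidual (M : Matrix (Fin d) (Fin d) ℝ) (J : Matrix (Fin d) (Fin k) ℝ) :
    Matrix (Fin d) (Fin d) ℝ :=
  M - M * J * wlsMatrix M J

variable {M C : Matrix (Fin d) (Fin d) ℝ} {J : Matrix (Fin d) (Fin k) ℝ}

theorem isUnit_det_transpose_mul_mul (hM : M.PosDef) (hJ : J.rank = k) :
    IsUnit (Jᵀ * M * J).det := by
  have h := hM.conjTranspose_mul_mul_same (mulVec_injective_of_rank_eq hJ)
  rw [conjTranspose_eq_transpose_of_trivial] at h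
  exact h.det_pos.ne'.isUnit

theorem wlsMatrix_mul (hM : M.PosDef) (hJ : J.rank = k) : wlsMatrix M J * J = 1 := by
  rw [wlsMatrix, Matrix.mul_assoc, Matrix.mul_assoc, ← Matrix.mul_assoc Jᵀ]
  exact nonsing_inv_mul _ (isUnit_det_transpose_mul_mul hM hJ)

theorem isSymm_wlsResidual (hM : M.PosDef) : (wlsResidual M J)ᵀ = wlsResidual M J := by
  have hMt : Mᵀ = M := by simpa using hM.isHermitian.eq
  simp only [wlsResidual, wlsMatrix, transpose_sub, transpose_mul, transpose_nonsing_inv, hMt,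
    transpose_transpose, Matrix.mul_assoc]

/-- The normal equations: fitted residuals are M-orthogonal to the range of J. -/
theorem transpose_mul_mul_one_sub (hM : M.PosDef) (hJ : J.rank = k) :
    Jᵀ * M * (1 - J * wlsMatrix M J) = 0 := by
  rw [Matrix.mul_sub, Matrix.mul_one, wlsMatrix, ← Matrix.mul_assoc, ← Matrix.mul_assoc,
    ← Matrix.mul_assoc, mul_nonsing_inv _ (isUnit_det_transpose_mul_mul hM hJ), Matrix.one_mul,
    sub_self]

theorem dotProduct_wlsResidual (hM : M.PosDef) (hJ : J.rank = k) (x : Fin d → ℝ) :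
    x ⬝ᵥ wlsResidual M J *ᵥ x =
      (x - J *ᵥ (wlsMatrix M J *ᵥ x)) ⬝ᵥ M *ᵥ (x - J *ᵥ (wlsMatrix M J *ᵥ x)) := by
  set z := x - J *ᵥ (wlsMatrix M J *ᵥ x) with hz
  have h1 : (1 - J * wlsMatrix M J) *ᵥ x = z := by
    rw [sub_mulVec, one_mulVec, ← mulVec_mulVec]
  have h2 : wlsResidual M J *ᵥ x = M *ᵥ z := by
    rw [← h1, mulVec_mulVec, Matrix.mul_sub, Matrix.mul_one, wlsResidual, Matrix.mul_assoc]
  have h3 : Jᵀ *ᵥ (M *ᵥ z) = 0 := by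
    rw [← h1, mulVec_mulVec, mulVec_mulVec, transpose_mul_mul_one_sub hM hJ, zero_mulVec]
  have h4 : (J *ᵥ (wlsMatrix M J *ᵥ x)) ⬝ᵥ M *ᵥ z = 0 := by
    rw [dotProduct_comm, dotProduct_mulVec, ← mulVec_transpose, h3, zero_dotProduct]
  have h5 : x = z + J *ᵥ (wlsMatrix M J *ᵥ x) := by rw [hz]; abel
  rw [h2]
  conv_lhs => rw [h5, add_dotProduct, h4, add_zero]

/-- Pythagoras for the inner product of M. -/
theorem dotProduct_wls_le (hM : M.PosDef) (hJ : J.rank = k) (x : Fin d → ℝ) (h : Fin k → ℝ) :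
    (x - J *ᵥ (wlsMatrix M J *ᵥ x)) ⬝ᵥ M *ᵥ (x - J *ᵥ (wlsMatrix M J *ᵥ x)) ≤
      (x - J *ᵥ h) ⬝ᵥ M *ᵥ (x - J *ᵥ h) := by
  set z := x - J *ᵥ (wlsMatrix M J *ᵥ x) with hz
  have hMt : Mᵀ = M := by simpa using hM.isHermitian.eq
  have h1 : (1 - J * wlsMatrix M J) *ᵥ x = z := by
    rw [sub_mulVec, one_mulVec, ← mulVec_mulVec]
  have h3 : Jᵀ *ᵥ (M *ᵥ z) = 0 := by
    rw [← h1, mulVec_mulVec, mulVec_mulVec, transpose_mul_mul_one_sub hM hJ, zero_mulVec]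
  set u := wlsMatrix M J *ᵥ x - h
  have h4 : x - J *ᵥ h = z + J *ᵥ u := by
    rw [hz, mulVec_sub]; abel
  have h5 : (J *ᵥ u) ⬝ᵥ M *ᵥ z = 0 := by
    rw [dotProduct_comm, dotProduct_mulVec, ← mulVec_transpose, h3, zero_dotProduct]
  have h6 : z ⬝ᵥ M *ᵥ (J *ᵥ u) = 0 := by
    rw [dotProduct_mulVec, ← mulVec_transpose, hMt, dotProduct_comm, h5]
  have h7 : 0 ≤ (J *ᵥ u) ⬝ᵥ M *ᵥ (J *ᵥ u) := by
    simpa using hM.posSemidef.dotProduct_mulVec_nonneg (J *ᵥ u)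
  rw [h4, mulVec_add, add_dotProduct, dotProduct_add, dotProduct_add, h5, h6]
  linarith

/-- Let P = J W, with W the least squares matrix; P is idempotent because W J = 1. The identities
give CG = CM - P, hence CGC = C - PC, which P annihilates. -/
theorem mul_wlsResidual_mul (hM : M.PosDef) (hJ : J.rank = k) (hCMC : C * M * C = C)
    (hCMJ : C * M * J = J) :
    C * wlsResidual M J * C * wlsResidual M J * C = C * wlsResidual M J * C := by
  have h1 : C * wlsResidual M J = C * M - J * wlsMatrix M J := by
    rw [wlsResidual, Matrix.mul_sub, ← Matrix.mul_assoc, ← Matrix.mul_assoc, hCMJ]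
  have h2 : C * wlsResidual M J * C = C - J * wlsMatrix M J * C := by
    rw [h1, Matrix.sub_mul, hCMC]
  have h3 : J * wlsMatrix M J * (J * wlsMatrix M J) = J * wlsMatrix M J := by
    rw [Matrix.mul_assoc, ← Matrix.mul_assoc (wlsMatrix M J), wlsMatrix_mul hM hJ, Matrix.one_mul]
  rw [h2, Matrix.sub_mul, Matrix.sub_mul, Matrix.mul_assoc (J * wlsMatrix M J),
    Matrix.mul_assoc (J * wlsMatrix M J) (C * _), h2, Matrix.mul_sub, ← Matrix.mul_assoc _ _ C, h3,
    sub_self, sub_zero]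

/-- CM is idempotent of the same rank as C, so its trace is rank C; the subtracted part J W has
trace tr(W J) = k. -/
theorem trace_mul_wlsResidual (hM : M.PosDef) (hJ : J.rank = k) (hCMC : C * M * C = C)
    (hCMJ : C * M * J = J) : (C * wlsResidual M J).trace = ((C.rank - k : ℕ) : ℝ) := by
  have h1 : C * wlsResidual M J = C * M - J * wlsMatrix M J := by
    rw [wlsResidual, Matrix.mul_sub, ← Matrix.mul_assoc, ← Matrix.mul_assoc, hCMJ]
  have h2 : (C * M).rank = C.rank := by
    refine le_antisymm (rank_mul_le_left C M) ?_
    conv_lhs => rw [← hCMC]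
    exact rank_mul_le_left _ _
  -- The natural-number subtraction does not truncate: J = C(MJ) factors through C.
  have h3 : k ≤ C.rank := by
    conv_lhs => rw [← hJ, ← hCMJ, Matrix.mul_assoc]
    exact rank_mul_le_left _ _
  rw [h1, trace_sub, trace_mul_comm J, wlsMatrix_mul hM hJ, trace_one, Fintype.card_fin,
    trace_eq_rank_of_mul_self (by rw [← Matrix.mul_assoc, hCMC]), h2, Nat.cast_sub h3]

end WeightedLeastSquares

/-! ### Convergence in probability and in distribution. -/

section Convergence

variable {Ω ι : Type*} [MeasurableSpace Ω] {μ : Measure Ω} {l : Filter ι}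

theorem TendstoInMeasure.tendsto_measure_notMem {S : Type*} [PseudoMetricSpace S]
    {X : ι → Ω → S} {c : S} (h : TendstoInMeasure μ X l fun _ => c) {U : Set S} (hU : U ∈ 𝓝 c) :
    Tendsto (fun n => μ {ω | X n ω ∉ U}) l (𝓝 0) := by
  obtain ⟨δ, hδ, hδU⟩ := Metric.mem_nhds_iff.1 hU
  refine tendsto_of_tendsto_of_tendsto_of_le_of_le tendsto_const_nhds
    (tendstoInMeasure_iff_dist.1 h δ hδ) (fun _ => zero_le) fun n => measure_mono fun ω hω => ?_
  exact not_lt.1 fun h => hω (hδU (Metric.mem_ball.2 h))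

theorem tendsto_measure_prodMk_notMem {S T : Type*} [PseudoMetricSpace S] [PseudoMetricSpace T]
    {X : ι → Ω → S} {Y : ι → Ω → T} {a : S} {b : T} (hX : TendstoInMeasure μ X l fun _ => a)
    (hY : TendstoInMeasure μ Y l fun _ => b) {U : Set (S × T)} (hU : U ∈ 𝓝 (a, b)) :
    Tendsto (fun n => μ {ω | (X n ω, Y n ω) ∉ U}) l (𝓝 0) := by
  obtain ⟨U₁, hU₁, U₂, hU₂, hU'⟩ := mem_nhds_prod_iff.1 hU
  have h := (TendstoInMeasure.tendsto_measure_notMem hX hU₁).add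
    (TendstoInMeasure.tendsto_measure_notMem hY hU₂)
  rw [add_zero] at h
  refine tendsto_of_tendsto_of_tendsto_of_le_of_le tendsto_const_nhds h (fun _ => zero_le)
    fun n => (measure_mono fun ω hω => ?_).trans (measure_union_le _ _)
  by_contra hcon
  simp only [Set.mem_union, Set.mem_ofPred_eq, not_or, not_not] at hcon
  exact hω (hU' ⟨hcon.1, hcon.2⟩)

variable [IsProbabilityMeasure μ]

/-- The closed set of points at distance at least δ from c, and its frontier, are null for the point
mass at c, so the portmanteau theorem applies. -/
theorem TendstoInDistribution.tendstoInMeasure_const {F Ω' : Type*} [NormedAddCommGroup F]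
    [MeasurableSpace F] [BorelSpace F] [MeasurableSpace Ω'] {μ' : Measure Ω'}
    [IsProbabilityMeasure μ'] {X : ι → Ω → F} {c : F}
    (h : TendstoInDistribution X l (fun _ : Ω' => c) (fun _ => μ) μ') :
    TendstoInMeasure μ X l (fun _ => c) := by
  rw [tendstoInMeasure_iff_dist]
  intro δ hδ
  have hcl : IsClosed {x : F | δ ≤ dist x c} := isClosed_le continuous_const (by fun_prop)
  have hc : c ∉ {x : F | δ ≤ dist x c} := by simpa using hδ
  have h0 : ∀ s : Set F, c ∉ s → (μ'.map fun _ => c) s = 0 := by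
    intro s hs
    rw [Measure.map_const, measure_univ, one_smul, Measure.dirac_apply, Set.indicator_of_notMem hs]
  have h1 := ProbabilityMeasure.tendsto_measure_of_null_frontier_of_tendsto' h.tendsto
    (E := {x : F | δ ≤ dist x c}) (h0 _ fun hx => hc (hcl.frontier_subset hx))
  simp only [ProbabilityMeasure.coe_mk, h0 _ hc] at h1
  refine h1.congr fun n => ?_
  rw [Measure.map_apply_of_aemeasurable (h.forall_aemeasurable n) hcl.measurableSet]
  rfl

/-- Slutsky: multiplying by 1/√n → 0 makes the limit constant. -/
theorem tendstoInMeasure_of_tendstoInDistribution_sqrt_smul {F Ω' : Type*} [NormedAddCommGroup F]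
    [InnerProductSpace ℝ F] [SecondCountableTopology F]
    [MeasurableSpace F] [BorelSpace F] [MeasurableSpace Ω'] {μ' : Measure Ω'}
    [IsProbabilityMeasure μ'] {V : ℕ → Ω → F} {a : F} {Z : Ω' → F}
    (h : TendstoInDistribution (fun (n : ℕ) ω => √(n : ℝ) • (V n ω - a)) atTop Z
      (fun _ => μ) μ') :
    TendstoInMeasure μ V atTop (fun _ => a) := by
  have h1 : Tendsto (fun n : ℕ => (√(n : ℝ))⁻¹) atTop (𝓝 0) :=
    (Real.tendsto_sqrt_atTop.comp tendsto_natCast_atTop_atTop).inv_tendsto_atTop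
  have h2 : TendstoInMeasure μ (fun (n : ℕ) (_ : Ω) => (√(n : ℝ))⁻¹) atTop (fun _ => (0 : ℝ)) :=
    tendstoInMeasure_of_tendsto_ae (fun _ => aestronglyMeasurable_const) (ae_of_all _ fun _ => h1)
  have h3 := h.continuous_comp_prodMk_of_tendstoInMeasure_const
    (g := fun p : F × ℝ => p.2 • p.1 + a) (by fun_prop) h2 (fun _ => aemeasurable_const)
  simp only [zero_smul, zero_add] at h3
  refine (TendstoInDistribution.tendstoInMeasure_const h3).congr' ?_ (EventuallyEq.refl _ _)
  filter_upwards [eventually_gt_atTop 0] with n hn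
  have : √(n : ℝ) ≠ 0 := by positivity
  refine ae_of_all _ fun ω => ?_
  simp [smul_smul, this]

end Convergence

theorem ContinuousOn.aemeasurable_comp {Ω S : Type*} [MeasurableSpace Ω] {μ : Measure Ω}
    [TopologicalSpace S] [MeasurableSpace S] [BorelSpace S] {f : S → ℝ} {s : Set S}
    (hf : ContinuousOn f s) (hs : MeasurableSet s) {X : Ω → S} (hX : AEMeasurable X μ)
    (hXs : ∀ᵐ ω ∂μ, X ω ∈ s) : AEMeasurable (fun ω => f (X ω)) μ := by
  classical
  have h1 : Measurable (s.piecewise f fun _ => 0) :=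
    hf.measurable_piecewise continuousOn_const hs
  refine (h1.comp_aemeasurable hX).congr ?_
  filter_upwards [hXs] with ω hω
  simp [hω]

/-! ### The deterministic estimates for the regular model. -/

section Model

variable {k d : ℕ} {Θ : Set (EuclideanSpace ℝ (Fin k))} {θ₀ : EuclideanSpace ℝ (Fin k)}
  {A : EuclideanSpace ℝ (Fin k) → EuclideanSpace ℝ (Fin d)}
  {M : EuclideanSpace ℝ (Fin k) → Matrix (Fin d) (Fin d) ℝ}

open scoped RealInnerProductSpace

theorem plugInChiSquare_eq_inner (n : ℕ) (v : EuclideanSpace ℝ (Fin d))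
    (θ' θ : EuclideanSpace ℝ (Fin k)) :
    plugInChiSquare A M n v θ' θ =
      n * ⟪v - A θ, toEuclideanCLM (𝕜 := ℝ) (M θ') (v - A θ)⟫ := by
  rw [plugInChiSquare, inner_toEuclideanCLM]

theorem isMinOn_plugInChiSquare_iff {n : ℕ} (hn : 0 < n) (v : EuclideanSpace ℝ (Fin d))
    (θ' θ : EuclideanSpace ℝ (Fin k)) :
    IsMinOn (plugInChiSquare A M n v θ') Θ θ ↔
      IsMinOn (fun θ => ⟪v - A θ, toEuclideanCLM (𝕜 := ℝ) (M θ') (v - A θ)⟫) Θ θ := by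
  have hn' : (0 : ℝ) < n := by exact_mod_cast hn
  simp only [isMinOn_iff, plugInChiSquare_eq_inner, mul_le_mul_iff_right₀ hn']

/-- Otherwise some sequence in Θ stays outside U while its images converge to A θ₀, against
bicontinuity. -/
theorem BicontinuousOn.exists_forall_norm_sub_lt (hA : BicontinuousOn A Θ) (hθ₀ : θ₀ ∈ Θ)
    {U : Set (EuclideanSpace ℝ (Fin k))} (hU : U ∈ 𝓝 θ₀) :
    ∃ δ > 0, ∀ θ ∈ Θ, ‖A θ - A θ₀‖ < δ → θ ∈ U := by
  by_contra! h
  choose u huΘ hu huU using fun n : ℕ => h (1 / ((n : ℝ) + 1)) (by positivity)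
  have h1 : Tendsto (fun n => A (u n)) atTop (𝓝 (A θ₀)) := by
    rw [tendsto_iff_norm_sub_tendsto_zero]
    exact squeeze_zero (fun _ => norm_nonneg _) (fun n => (hu n).le)
      tendsto_one_div_add_atTop_nhds_zero_nat
  obtain ⟨n, hn⟩ := (((hA θ₀ hθ₀ u huΘ).2 h1).eventually_mem hU).exists
  exact huU n hn

theorem fderiv_apply_eq_jacobianMatrix_mulVec (θ h : EuclideanSpace ℝ (Fin k)) :
    (fderiv ℝ A θ h).ofLp = jacobianMatrix A θ *ᵥ h.ofLp := by
  have h1 : h = ∑ j, h j • EuclideanSpace.single j (1 : ℝ) := by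
    simpa using ((EuclideanSpace.basisFun (Fin k) ℝ).sum_repr h).symm
  ext i
  conv_lhs => rw [h1, map_sum]
  simp [jacobianMatrix, mulVec, dotProduct, mul_comm]

namespace RegularModel

variable (hreg : RegularModel Θ θ₀ A M)
include hreg

theorem exists_le_inner :
    ∃ η : ℝ, 0 < η ∧ ∀ᶠ θ in 𝓝 θ₀, ∀ y : EuclideanSpace ℝ (Fin d),
      η * ‖y‖ ^ 2 ≤ ⟪y, toEuclideanCLM (𝕜 := ℝ) (M θ) y⟫ := by
  obtain ⟨η, hη, h⟩ := hreg.uniformly_posDef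
  refine ⟨η, hη, ?_⟩
  filter_upwards [h] with θ hθ y
  have h1 := hθ.posSemidef.dotProduct_mulVec_nonneg y.ofLp
  rw [sub_mulVec, dotProduct_sub, smul_mulVec, one_mulVec, dotProduct_smul, star_trivial] at h1
  rw [inner_toEuclideanCLM, EuclideanSpace.real_norm_sq_eq]
  simp only [dotProduct, smul_eq_mul, ← pow_two] at h1 ⊢
  linarith

theorem posDef : (M θ₀).PosDef := by
  obtain ⟨η, hη, h⟩ := hreg.uniformly_posDef
  have := h.self_of_nhds.add (PosDef.one.smul hη)
  simpa using this

theorem continuousAt_toEuclideanCLM (hΘ : Θ ∈ 𝓝 θ₀) :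
    ContinuousAt (fun θ => toEuclideanCLM (𝕜 := ℝ) (M θ)) θ₀ := by
  have h1 : Continuous (toEuclideanCLM (n := Fin d) (𝕜 := ℝ)) :=
    LinearMap.continuous_of_finiteDimensional
      (toEuclideanCLM (n := Fin d) (𝕜 := ℝ)).toAlgEquiv.toLinearMap
  exact h1.continuousAt.comp (hreg.continuousOn.continuousAt hΘ)

theorem hasFDerivAt (hΘ : Θ ∈ 𝓝 θ₀) : HasFDerivAt A (fderiv ℝ A θ₀) θ₀ :=
  ((hreg.contDiffOn.contDiffAt hΘ).differentiableAt one_ne_zero).hasFDerivAt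

theorem antilipschitz_fderiv (hθ₀ : θ₀ ∈ Θ) : ∃ c, AntilipschitzWith c (fderiv ℝ A θ₀) := by
  have h1 : LinearMap.ker (fderiv ℝ A θ₀).toLinearMap = ⊥ := by
    rw [LinearMap.ker_eq_bot]
    intro x y hxy
    have h2 := congrArg WithLp.ofLp hxy
    simp only [ContinuousLinearMap.coe_coe, fderiv_apply_eq_jacobianMatrix_mulVec] at h2
    exact WithLp.ofLp_injective 2
      (mulVec_injective_of_rank_eq (hreg.rank_jacobian θ₀ hθ₀) h2)
  obtain ⟨c, -, hc⟩ := (fderiv ℝ A θ₀).toLinearMap.exists_antilipschitzWith h1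
  exact ⟨c, hc⟩

/-- Near the truth, the minimum of the quadratic form is attained, and it agrees with the weighted
residual sum of squares of the linearized model up to an error of smaller order. -/
theorem eventually_attained_and_abs_sub_le (hΘ : IsOpen Θ) (hθ₀ : θ₀ ∈ Θ) {ε : ℝ} (hε : 0 < ε) :
    ∀ᶠ p : EuclideanSpace ℝ (Fin d) × EuclideanSpace ℝ (Fin k) in 𝓝 (A θ₀, θ₀),
      (∃ θ ∈ Θ, IsMinOn
        (fun θ => ⟪p.1 - A θ, toEuclideanCLM (𝕜 := ℝ) (M p.2) (p.1 - A θ)⟫) Θ θ) ∧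
      ∀ θ ∈ Θ, IsMinOn
        (fun θ => ⟪p.1 - A θ, toEuclideanCLM (𝕜 := ℝ) (M p.2) (p.1 - A θ)⟫) Θ θ →
        |⟪p.1 - A θ, toEuclideanCLM (𝕜 := ℝ) (M p.2) (p.1 - A θ)⟫ -
          ⟪p.1 - A θ₀, toEuclideanCLM (𝕜 := ℝ) (wlsResidual (M θ₀) (jacobianMatrix A θ₀))
            (p.1 - A θ₀)⟫| ≤ ε * ‖p.1 - A θ₀‖ ^ 2 := by
  have hnhds := hΘ.mem_nhds hθ₀
  have hrank := hreg.rank_jacobian θ₀ hθ₀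
  have hT := hreg.continuousAt_toEuclideanCLM hnhds
  have hinv : ∀ U ∈ 𝓝 θ₀, ∃ δ > 0, ∀ θ ∈ Θ, ‖A θ - A θ₀‖ < δ → θ ∈ U :=
    fun U hU => hreg.bicontinuous.exists_forall_norm_sub_lt hθ₀ hU
  obtain ⟨c, hc⟩ := hreg.antilipschitz_fderiv hθ₀
  set W := wlsMatrix (M θ₀) (jacobianMatrix A θ₀) with hW
  set H := (toEuclideanLin W).toContinuousLinearMap with hH
  have hHx : ∀ x, (H x).ofLp = W *ᵥ x.ofLp := fun x => rfl
  have hopt : ∀ x h, ⟪x - fderiv ℝ A θ₀ (H x),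
      toEuclideanCLM (𝕜 := ℝ) (M θ₀) (x - fderiv ℝ A θ₀ (H x))⟫ ≤
      ⟪x - fderiv ℝ A θ₀ h, toEuclideanCLM (𝕜 := ℝ) (M θ₀) (x - fderiv ℝ A θ₀ h)⟫ := by
    intro x h
    simp only [inner_toEuclideanCLM, WithLp.ofLp_sub, fderiv_apply_eq_jacobianMatrix_mulVec, hHx]
    exact dotProduct_wls_le hreg.posDef hrank _ _
  filter_upwards [eventually_exists_isMinOn hnhds hreg.contDiffOn.continuousOn hT
      hreg.exists_le_inner hinv,
    eventually_abs_isMinOn_sub_le hnhds (hreg.hasFDerivAt hnhds) hc hT hreg.exists_le_inner hinv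
      hopt hε] with p hp1 hp2
  refine ⟨hp1, fun θ hθ hmin => ?_⟩
  have h := hp2 θ hθ hmin
  have h1 : ∀ x : EuclideanSpace ℝ (Fin d), ⟪x - fderiv ℝ A θ₀ (H x),
      toEuclideanCLM (𝕜 := ℝ) (M θ₀) (x - fderiv ℝ A θ₀ (H x))⟫ =
      ⟪x, toEuclideanCLM (𝕜 := ℝ) (wlsResidual (M θ₀) (jacobianMatrix A θ₀)) x⟫ := by
    intro x
    simp only [inner_toEuclideanCLM, WithLp.ofLp_sub, fderiv_apply_eq_jacobianMatrix_mulVec, hHx]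
    exact (dotProduct_wlsResidual hreg.posDef hrank _).symm
  rwa [h1] at h

theorem aemeasurable_plugInChiSquare (hΘ : IsOpen Θ) {Ω : Type*} [MeasurableSpace Ω]
    {μ : Measure Ω} (n : ℕ) {V : Ω → EuclideanSpace ℝ (Fin d)}
    {X Y : Ω → EuclideanSpace ℝ (Fin k)} (hV : AEMeasurable V μ) (hX : AEMeasurable X μ)
    (hXΘ : ∀ᵐ ω ∂μ, X ω ∈ Θ) (hY : AEMeasurable Y μ) (hYΘ : ∀ᵐ ω ∂μ, Y ω ∈ Θ) :
    AEMeasurable (fun ω => plugInChiSquare A M n (V ω) (X ω) (Y ω)) μ := by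
  have hA : ∀ i, AEMeasurable (fun ω => A (Y ω) i) μ := fun i =>
    ContinuousOn.aemeasurable_comp (f := fun θ => A θ i)
      (by have := hreg.contDiffOn.continuousOn; fun_prop) hΘ.measurableSet hY hYΘ
  have hM : ∀ i j, AEMeasurable (fun ω => M (X ω) i j) μ := fun i j =>
    ContinuousOn.aemeasurable_comp (f := fun θ => M θ i j)
      ((continuous_id.matrix_elem i j).comp_continuousOn hreg.continuousOn) hΘ.measurableSet hX hXΘ
  have hVi : ∀ i, AEMeasurable (fun ω => V ω i) μ := fun i =>
    (by fun_prop : Measurable fun v : EuclideanSpace ℝ (Fin d) => v i).comp_aemeasurable hV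
  simp only [plugInChiSquare, dotProduct, mulVec, WithLp.ofLp_sub, Pi.sub_apply]
  refine AEMeasurable.const_mul (Finset.aemeasurable_fun_sum _ fun i _ =>
    ((hVi i).sub (hA i)).mul (Finset.aemeasurable_fun_sum _ fun j _ => ?_)) _
  exact (hM i j).mul ((hVi j).sub (hA j))

end RegularModel

end Model

theorem mainTheorem2 {k d : ℕ} {Ω : Type*} [MeasurableSpace Ω] (μ : Measure Ω)
    [IsProbabilityMeasure μ]
    -- the parameter space, the true parameter, the model, the middle matrix, the covariance matrix
    (Θ : Set (EuclideanSpace ℝ (Fin k))) (hΘ : IsOpen Θ)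
    (θ₀ : EuclideanSpace ℝ (Fin k)) (hθ₀ : θ₀ ∈ Θ)
    (A : EuclideanSpace ℝ (Fin k) → EuclideanSpace ℝ (Fin d))
    (M C : EuclideanSpace ℝ (Fin k) → Matrix (Fin d) (Fin d) ℝ)
    (hreg : RegularModel Θ θ₀ A M)
    (hC : ∀ θ ∈ Θ, (C θ).PosSemidef)
    -- the data vectors, and their asymptotic normality
    (V : ℕ → Ω → EuclideanSpace ℝ (Fin d)) (hV : ∀ n, AEMeasurable (V n) μ)
    (hnormal : TendstoInDistribution (fun (n : ℕ) ω => √(n : ℝ) • (V n ω - A θ₀)) atTop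
      (id : EuclideanSpace ℝ (Fin d) → EuclideanSpace ℝ (Fin d))
      (fun _ => μ) (multivariateGaussian 0 (C θ₀)))
    -- the consistent preliminary estimate based on the data
    (φ : ℕ → EuclideanSpace ℝ (Fin d) → EuclideanSpace ℝ (Fin k)) (hφ : ∀ n, Measurable (φ n))
    (hφΘ : ∀ n, ∀ᵐ ω ∂μ, φ n (V n ω) ∈ Θ)
    (hφ₀ : TendstoInMeasure μ (fun n ω => φ n (V n ω)) atTop (fun _ => θ₀))
    -- the two matrix identities
    (hCMC : ∀ θ ∈ Θ, C θ * M θ * C θ = C θ)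
    (hCMA : ∀ θ ∈ Θ, C θ * M θ * jacobianMatrix A θ = jacobianMatrix A θ)
    -- the estimator: it minimizes the statistic over the parameter space
    -- whenever the minimum is attained
    (θhat : ℕ → Ω → EuclideanSpace ℝ (Fin k)) (hθhat : ∀ n, AEMeasurable (θhat n) μ)
    (hθhatΘ : ∀ n, ∀ᵐ ω ∂μ, θhat n ω ∈ Θ)
    (hmin : ∀ n, ∀ᵐ ω ∂μ,
      (∃ θ ∈ Θ, IsMinOn (plugInChiSquare A M n (V n ω) (φ n (V n ω))) Θ θ) →
        IsMinOn (plugInChiSquare A M n (V n ω) (φ n (V n ω))) Θ (θhat n ω)) :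
    TendstoInDistribution
      (fun n ω => plugInChiSquare A M n (V n ω) (φ n (V n ω)) (θhat n ω)) atTop
      (id : ℝ → ℝ) (fun _ => μ) (chiSquare ((C θ₀).rank - k)) := by
  set G := wlsResidual (M θ₀) (jacobianMatrix A θ₀) with hG
  set g : EuclideanSpace ℝ (Fin d) → ℝ := fun z => inner ℝ z (toEuclideanCLM (𝕜 := ℝ) G z) with hg
  have hgc : Continuous g := by fun_prop
  set Z : ℕ → Ω → EuclideanSpace ℝ (Fin d) := fun n ω => √(n : ℝ) • (V n ω - A θ₀) with hZ
  set R : ℕ → Ω → ℝ := fun n ω => plugInChiSquare A M n (V n ω) (φ n (V n ω)) (θhat n ω) with hR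
  have hRm : ∀ n, AEMeasurable (R n) μ := fun n =>
    hreg.aemeasurable_plugInChiSquare hΘ n (hV n) ((hφ n).comp_aemeasurable (hV n)) (hφΘ n)
      (hθhat n) (hθhatΘ n)
  have hZm : ∀ n, AEMeasurable (Z n) μ := hnormal.forall_aemeasurable
  have hVc := tendstoInMeasure_of_tendstoInDistribution_sqrt_smul hnormal
  have hD : ∀ z : EuclideanSpace ℝ (Fin d), 0 < 1 + ‖z‖ ^ 2 := fun z => by positivity
  -- Normalizing by 1 + ‖Z‖² gives an error that tends to 0 in probability without any appeal to
  -- tightness of Z.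
  set E : ℕ → Ω → ℝ := fun n ω => (R n ω - g (Z n ω)) / (1 + ‖Z n ω‖ ^ 2) with hE
  have hEm : ∀ n, AEMeasurable (E n) μ := fun n =>
    ((hRm n).sub (hgc.measurable.comp_aemeasurable (hZm n))).div
      ((by fun_prop : Measurable fun z : EuclideanSpace ℝ (Fin d) => 1 + ‖z‖ ^ 2).comp_aemeasurable
        (hZm n))
  have hE0 : TendstoInMeasure μ E atTop (fun _ => (0 : ℝ)) := by
    rw [tendstoInMeasure_iff_norm]
    intro ε hε
    have hev := hreg.eventually_attained_and_abs_sub_le hΘ hθ₀ (half_pos hε)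
    refine tendsto_of_tendsto_of_tendsto_of_le_of_le' tendsto_const_nhds
      (tendsto_measure_prodMk_notMem hVc hφ₀ hev) (Eventually.of_forall fun _ => zero_le) ?_
    filter_upwards [eventually_gt_atTop 0] with n hn
    refine measure_mono_ae ?_
    filter_upwards [hθhatΘ n, hmin n] with ω h1 h2 h3 h4
    simp only [isMinOn_plugInChiSquare_iff hn] at h2
    have h5 := h4.2 _ h1 (h2 h4.1)
    have hsq : √(n : ℝ) * √(n : ℝ) = n := Real.mul_self_sqrt n.cast_nonneg
    have hgZ : g (Z n ω) = n * g (V n ω - A θ₀) := by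
      simp only [hg, hZ, map_smul, inner_smul_left, inner_smul_right, ← mul_assoc]
      simp [hsq]
    have hZn : ‖Z n ω‖ ^ 2 = n * ‖V n ω - A θ₀‖ ^ 2 := by
      rw [hZ, norm_smul, mul_pow, Real.norm_eq_abs, sq_abs, Real.sq_sqrt n.cast_nonneg]
    have h6 : |R n ω - g (Z n ω)| ≤ ε / 2 * ‖Z n ω‖ ^ 2 := by
      have h7 : R n ω = n * _ := plugInChiSquare_eq_inner n _ _ _
      rw [h7, hgZ, hZn, ← mul_sub, abs_mul, Nat.abs_cast, mul_left_comm]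
      gcongr
    have h8 : ε ≤ ‖E n ω - 0‖ := h3
    rw [sub_zero, Real.norm_eq_abs, hE, abs_div, abs_of_pos (hD _), le_div_iff₀ (hD _)] at h8
    nlinarith [sq_nonneg ‖Z n ω‖]
  -- Slutsky for the pair (Z, E): undoing the normalization recovers R, and the limit E = 0 leaves
  -- g.
  have hlim := hnormal.continuous_comp_prodMk_of_tendstoInMeasure_const
    (g := fun p : EuclideanSpace ℝ (Fin d) × ℝ => g p.1 + p.2 * (1 + ‖p.1‖ ^ 2)) (by fun_prop)
    hE0 hEm
  have hRE : ∀ n ω, g (Z n ω) + E n ω * (1 + ‖Z n ω‖ ^ 2) = R n ω := by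
    intro n ω
    rw [hE, div_mul_cancel₀ _ (hD _).ne', add_sub_cancel]
  simp only [zero_mul, add_zero, id_eq, hRE] at hlim
  have hlaw : (multivariateGaussian 0 (C θ₀)).map g = chiSquare ((C θ₀).rank - k) := by
    have hrank := hreg.rank_jacobian θ₀ hθ₀
    refine map_inner_multivariateGaussian_eq_chiSquare (hC θ₀ hθ₀) ?_
      (mul_wlsResidual_mul hreg.posDef hrank (hCMC θ₀ hθ₀) (hCMA θ₀ hθ₀))
      (trace_mul_wlsResidual hreg.posDef hrank (hCMC θ₀ hθ₀) (hCMA θ₀ hθ₀))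
    rw [IsHermitian, conjTranspose_eq_transpose_of_trivial]
    exact isSymm_wlsResidual hreg.posDef
  refine ⟨hRm, aemeasurable_id, ?_⟩
  have hχ : (⟨(chiSquare ((C θ₀).rank - k)).map id, Measure.isProbabilityMeasure_map
      aemeasurable_id⟩ : ProbabilityMeasure ℝ) =
      ⟨(multivariateGaussian 0 (C θ₀)).map g, Measure.isProbabilityMeasure_map
        hgc.measurable.aemeasurable⟩ :=
    Subtype.ext (Measure.map_id.trans hlaw.symm)
  rw [hχ]
  exact hlim.tendsto
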